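/- A labelled digraph on $n\ge 0$ vertices has vertex set $\{1,\dots,n\}$ and no loops or multiple edges. A digraph is strongly connected if it is non-empty and every vertex is reachable from every other by a directed path. For numbers $a_n$ counting a class of labelled digraphs by number of vertices, its Exponential GF is $\sum_n a_n z^n/n!$ and its Graphic GF is $\sum_n a_n 2^{-\binom n2} z^n/n!$. Let $\mathsf{SCD}(z)$ be the Exponential GF of strongly connected digraphs, let $\widehat{S}_m(z)$ be the Graphic GF of digraphs having exactly $m$ strongly connected components, let $\widehat{\mathsf D}(z;t)=\sum_n\big(\sum_G t^{\mathrm{scc}(G)}\big)2^{-\binom n2}z^n/n!$, where $G$ runs over the labelled digraphs on $n$ vertices and $\mathrm{scc}(G)$ is the number of strongly connected components of $G$, and let $\widehat{\mathsf{Set}}(z)=\sum_n 2^{-\binom n2} z^n/n!$. The exponential Hadamard product is $$\Big(\sum_n a_n \frac{z^n}{n!}\Big)\odot\Big(\sum_n b_n\frac{z^n}{n!}\Big)=\sum_n a_nb_n\frac{z^n}{n!},$$ taken in the variable $z$. The exponential Bell polynomials are $$B_{n,k}(x_1,\dots,x_n)=\sum \frac{n!}{j_1!\cdots j_n!}\Big(\frac{x_1}{1!}\Big)^{j_1}\cdots\Big(\frac{x_n}{n!}\Big)^{j_n},$$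 where the sum is over all sequences of non-negative integers with $j_1+\dots+j_n=k$ and $j_1+2j_2+\dots+nj_n=n$. **Proposition.** As formal power series in $z$ over $\mathbb{Q}[t]$, $e^{-t\,\mathsf{SCD}(z)}\odot\widehat{\mathsf{Set}}(z)$ is invertible, and $$\widehat{\mathsf D}(z;t)=\frac{1}{e^{-t\,\mathsf{SCD}(z)}\odot\widehat{\mathsf{Set}}(z)}.$$ For every $m\ge 0$, $$\widehat S_m(z)=[t^m]\,\frac{1}{e^{-t\,\mathsf{SCD}(z)}\odot\widehat{\mathsf{Set}}(z)},$$ and for every $m\ge 1$, $$\widehat S_m(z)=\sum_{k=1}^m\frac{k!}{m!}(-1)^{m+k}B_{m,k}\Big(\mathsf{SCD}(z)\odot\widehat{\mathsf{Set}}(z),\ \mathsf{SCD}(z)^2\odot\widehat{\mathsf{Set}}(z),\ \dots,\ \mathsf{SCD}(z)^m\odot\widehat{\mathsf{Set}}(z)\Big).$$ -/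

import Mathlib

open scoped Nat PowerSeries

/-! ### Labelled digraphs and their strongly connected components -/

/-- A labelled digraph on `n` vertices: a set of ordered pairs of distinct vertices
(no loops, no multiple edges). -/
def LabelledDigraph (n : ℕ) : Type :=
  {G : Digraph (Fin n) // ∀ v, ¬ G.Adj v v}

noncomputable instance (n : ℕ) : Fintype (LabelledDigraph n) :=
  haveI : Finite (LabelledDigraph n) :=
    inferInstanceAs (Finite {G : Digraph (Fin n) // ∀ v, ¬ G.Adj v v})
  Fintype.ofFinite _

namespace LabelledDigraph

variable {n : ℕ}

/-- There is a directed path, possibly of length zero, from `u` to `v`. -/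
def Reachable (G : LabelledDigraph n) (u v : Fin n) : Prop :=
  Relation.ReflTransGen G.1.Adj u v

/-- Two vertices are equivalent when each of them is reachable from the other. -/
def sccSetoid (G : LabelledDigraph n) : Setoid (Fin n) where
  r u v := G.Reachable u v ∧ G.Reachable v u
  iseqv :=
    { refl := fun _ => ⟨Relation.ReflTransGen.refl, Relation.ReflTransGen.refl⟩
      symm := fun h => ⟨h.2, h.1⟩
      trans := fun h h' => ⟨h.1.trans h'.1, h'.2.trans h.2⟩ }

/-- The number of strongly connected components. -/
noncomputable def numSCC (G : LabelledDigraph n) : ℕ :=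
  Nat.card (Quotient G.sccSetoid)

/-- A strongly connected digraph is non-empty, and any vertex is reachable from any other. -/
def IsStronglyConnected (G : LabelledDigraph n) : Prop :=
  0 < n ∧ ∀ u v : Fin n, G.Reachable u v

end LabelledDigraph

/-- The number of strongly connected labelled digraphs on `n` vertices. -/
noncomputable def numStrong (n : ℕ) : ℕ :=
  Nat.card {G : LabelledDigraph n // G.IsStronglyConnected}

/-- The number of labelled digraphs on `n` vertices with exactly `m` strongly connected
components. -/
noncomputable def numWithSCC (m n : ℕ) : ℕ :=
  Nat.card {G : LabelledDigraph n // G.numSCC = m}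

/-! ### Generating functions -/

/-- The exponential generating function `∑ aₙ zⁿ / n!`. -/
noncomputable def exponentialGF (a : ℕ → ℕ) : ℚ⟦X⟧ :=
  PowerSeries.mk fun n => (a n : ℚ) / (n ! : ℚ)

/-- The graphic generating function `∑ aₙ 2^(-n(n-1)/2) zⁿ / n!`. -/
noncomputable def graphicGF (a : ℕ → ℕ) : ℚ⟦X⟧ :=
  PowerSeries.mk fun n => (a n : ℚ) / ((2 : ℚ) ^ n.choose 2 * (n ! : ℚ))

/-- The exponential GF of strongly connected digraphs. -/
noncomputable def SCD : ℚ⟦X⟧ := exponentialGF numStrong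

/-- The graphic GF of digraphs with exactly `m` strongly connected components. -/
noncomputable def graphicS (m : ℕ) : ℚ⟦X⟧ := graphicGF (numWithSCC m)

/-- The graphic GF of sets, i.e. of digraphs without edges: one for each `n`. -/
noncomputable def graphicSet : ℚ⟦X⟧ := graphicGF fun _ => 1

/-- The exponential Hadamard product
`(∑ aₙ zⁿ/n!) ⊙ (∑ bₙ zⁿ/n!) = ∑ aₙ bₙ zⁿ/n!`, in terms of ordinary coefficients. -/
noncomputable def expHadamard {R : Type*} [CommSemiring R] (A B : R⟦X⟧) : R⟦X⟧ :=
  PowerSeries.mk fun n => (n ! : R) * PowerSeries.coeff n A * PowerSeries.coeff n B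

/-! ### The component-marking variable

Series in `z` whose coefficients are polynomials in the formal variable `t`. -/

/-- A series in `z` seen as a series in `z` over `ℚ[t]`. -/
noncomputable def liftT (A : ℚ⟦X⟧) : (Polynomial ℚ)⟦X⟧ :=
  PowerSeries.map Polynomial.C A

/-- The bivariate graphic GF `∑ₙ (∑_G t^{scc(G)}) 2^(-n(n-1)/2) zⁿ / n!`, where `G` runs over
the labelled digraphs on `n` vertices and `scc(G)` is the number of strongly connected
components of `G`. -/
noncomputable def graphicD : (Polynomial ℚ)⟦X⟧ :=
  PowerSeries.mk fun n =>
    Polynomial.C (1 / ((2 : ℚ) ^ n.choose 2 * (n ! : ℚ))) *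
      ∑ G : LabelledDigraph n, Polynomial.X ^ G.numSCC

/-- The series `-t · SCD(z)`. -/
noncomputable def negTSCD : (Polynomial ℚ)⟦X⟧ :=
  -(PowerSeries.C (Polynomial.X : Polynomial ℚ) * liftT SCD)

/-- `-t · SCD(z)` has no constant term, so that it can be substituted into the exponential
series. -/
theorem hasSubst_negTSCD : PowerSeries.HasSubst negTSCD := by
  apply PowerSeries.HasSubst.of_constantCoeff_zero'
  have h : numStrong 0 = 0 := by
    have : IsEmpty {G : LabelledDigraph 0 // G.IsStronglyConnected} :=
      ⟨fun G => absurd G.2.1 (lt_irrefl 0)⟩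
    exact Nat.card_of_isEmpty
  have h' : PowerSeries.constantCoeff SCD = 0 := by
    rw [← PowerSeries.coeff_zero_eq_constantCoeff_apply]
    simp [SCD, exponentialGF, h]
  have h'' : PowerSeries.constantCoeff (liftT SCD) = 0 := by
    rw [← PowerSeries.coeff_zero_eq_constantCoeff_apply, liftT, PowerSeries.coeff_map,
      PowerSeries.coeff_zero_eq_constantCoeff_apply, h', map_zero]
  simp [negTSCD, h'']

/-- The series `e^{-t · SCD(z)}`. -/
noncomputable def expNegTSCD : (Polynomial ℚ)⟦X⟧ :=
  (PowerSeries.exp (Polynomial ℚ)).subst negTSCD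

/-- The coefficient of `t^m`, a series in `z`. -/
noncomputable def coeffT (m : ℕ) (F : (Polynomial ℚ)⟦X⟧) : ℚ⟦X⟧ :=
  PowerSeries.mk fun n => (PowerSeries.coeff n F).coeff m

/-! ### Bell polynomials -/

/-- The sequences `j₁, …, jₙ` of non-negative integers with `j₁ + ⋯ + jₙ = k` and
`j₁ + 2 j₂ + ⋯ + n jₙ = n`; the entry `j i` for `i : Fin n` stands for `j_{i+1}`. -/
def bellIndices (n k : ℕ) : Finset (Fin n → ℕ) :=
  (Fintype.piFinset fun _ => Finset.range (n + 1)).filter fun j =>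
    ∑ i : Fin n, j i = k ∧ ∑ i : Fin n, ((i : ℕ) + 1) * j i = n

/-- The range restriction in `bellIndices` loses nothing. -/
theorem mem_bellIndices {n k : ℕ} {j : Fin n → ℕ} :
    j ∈ bellIndices n k ↔ ∑ i : Fin n, j i = k ∧ ∑ i : Fin n, ((i : ℕ) + 1) * j i = n := by
  simp only [bellIndices, Finset.mem_filter, Fintype.mem_piFinset, Finset.mem_range,
    and_iff_right_iff_imp]
  rintro ⟨-, h⟩ i
  have h1 : ((i : ℕ) + 1) * j i ≤ ∑ i : Fin n, ((i : ℕ) + 1) * j i :=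
    Finset.single_le_sum (f := fun i : Fin n => ((i : ℕ) + 1) * j i)
      (fun _ _ => Nat.zero_le _) (Finset.mem_univ i)
  nlinarith [Nat.zero_le ((i : ℕ) * j i)]

/-- The exponential Bell polynomial `B_{n,k}(x₁, …, xₙ)`; the variable of index `i : Fin n`
is `x_{i+1}`. -/
noncomputable def bellPolynomial (n k : ℕ) : MvPolynomial (Fin n) ℚ :=
  ∑ j ∈ bellIndices n k,
    MvPolynomial.C ((n ! : ℚ) / ∏ i : Fin n, ((j i)! : ℚ)) *
      ∏ i : Fin n, (MvPolynomial.C (1 / (((i : ℕ) + 1)! : ℚ)) * MvPolynomial.X i) ^ j i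

/-!
Robinson's argument by inclusion and exclusion over the source components of a digraph.

Let `e_n` be the sum of `(-t) ^ (number of components)` over the digraphs on `n` vertices that are
disjoint unions of strongly connected digraphs, and `d_n` the sum of `t ^ scc` over all digraphs on
`n` vertices. Choosing such a union on a set `A` of `i` vertices, a digraph on the `j` remaining
vertices, and any of the `2 ^ (i * j)` sets of arrows from `A` to its complement is the same as
choosing a digraph together with a union `A` of some of its source components. A digraph thus
occurs with weight `t ^ scc` times the alternating sum of `(-1) ^ |T|` over the subsets `T` of its
set of source components (`sum_unions_of_sources`), which vanishes when there are vertices, since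
there is then a source component. Hence
`∑ (n choose i) 2 ^ (i j) e_i d_j = 0` over `i + j = n` for `n > 0`
(`sum_antidiagonal_symmSum_mul_digraphSum`). As `2 ^ (i j)` is the quotient of the graphic weights,
this says that the graphic generating functions of `e` and `d` are inverse to each other
(`expHadamard_mul_graphicD`).

The exponential generating function of `e` is `exp (-t SCD)` (`coeff_expNegTSCD`): marking a vertex
in a union of strongly connected digraphs singles out the component containing it
(`card_mul_symmSum`), which gives the recurrence equivalent to `z F' = z (-t SCD)' F`.

The formula with Bell polynomials follows by exchanging the roles of `z` and `t`: over `ℚ⟦z⟧`, the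
series to be inverted is `1 + ∑ (-t) ^ i / i! (SCD ^ i ⊙ Set)`, and the coefficients of the powers
in the geometric series for its reciprocal are Bell polynomials by the multinomial theorem
(`coeff_sum_pow_eq_aeval_bellPolynomial`, `coeff_of_mk_mul_eq_one`).
-/

open Relation

/-! ### Strongly connected classes of a relation -/

/-- Two points are equivalent for `r` when each is reachable from the other along `r`. -/
def mutualReach {V : Type*} (r : V → V → Prop) : Setoid V where
  r u v := ReflTransGen r u v ∧ ReflTransGen r v u
  iseqv :=
    { refl := fun _ => ⟨.refl, .refl⟩
      symm := fun h => ⟨h.2, h.1⟩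
      trans := fun h h' => ⟨h.1.trans h'.1, h'.2.trans h.2⟩ }

/-- The number of classes of mutually reachable points. -/
noncomputable def numClasses {V : Type*} (r : V → V → Prop) : ℕ :=
  Nat.card (Quotient (mutualReach r))

/-- The relation is non-empty and strongly connected. -/
def StronglyConnectedRel {V : Type*} (r : V → V → Prop) : Prop :=
  Nonempty V ∧ ∀ u v, Relation.ReflTransGen r u v

/-- Reachability is symmetric: the relation is a disjoint union of strongly connected pieces. -/
def SymmReach {V : Type*} (r : V → V → Prop) : Prop :=
  ∀ u v, Relation.ReflTransGen r u v → Relation.ReflTransGen r v u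

/-- The restriction of a relation to the points satisfying `p`. -/
def induced {V : Type*} (r : V → V → Prop) (p : V → Prop) (u v : Subtype p) : Prop :=
  r u v

/-- No arrow of `r` enters `A` from outside. -/
def NoArrowInto {V : Type*} (r : V → V → Prop) (A : Finset V) : Prop :=
  ∀ u v, r u v → v ∈ A → u ∈ A

theorem reflTransGen_of_induced {V : Type*} {r : V → V → Prop} {p : V → Prop} {u v : Subtype p}
    (h : ReflTransGen (induced r p) u v) : ReflTransGen r u v :=
  h.lift Subtype.val fun _ _ h => h

theorem NoArrowInto.induced_mem {V : Type*} {r : V → V → Prop} {A : Finset V}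
    (hA : NoArrowInto r A) {u v : V} (h : ReflTransGen r u v) (hv : v ∈ A) :
    ∃ hu : u ∈ A, ReflTransGen (induced r (· ∈ A)) ⟨u, hu⟩ ⟨v, hv⟩ := by
  induction h using ReflTransGen.head_induction_on with
  | refl => exact ⟨hv, .refl⟩
  | head h' _ ih =>
    obtain ⟨hc, ih⟩ := ih
    have step : induced r (· ∈ A) ⟨_, hA _ _ h' hc⟩ ⟨_, hc⟩ := h'
    exact ⟨hA _ _ h' hc, .head step ih⟩

theorem NoArrowInto.induced_notMem {V : Type*} {r : V → V → Prop} {A : Finset V}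
    (hA : NoArrowInto r A) {u v : V} (h : ReflTransGen r u v) (hu : u ∉ A) :
    ∃ hv : v ∉ A, ReflTransGen (induced r (· ∉ A)) ⟨u, hu⟩ ⟨v, hv⟩ := by
  induction h with
  | refl => exact ⟨hu, .refl⟩
  | tail _ h' ih =>
    obtain ⟨hb, ih⟩ := ih
    exact ⟨fun hc => hb (hA _ _ h' hc), .tail ih h'⟩

/-- If mutual reachability between points of `p` is witnessed inside `p`, the classes of the
restriction are the classes of `r` that meet `p`. -/
theorem numClasses_induced {V : Type*} {r : V → V → Prop} {p : V → Prop}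
    (hp : ∀ u v : Subtype p, ReflTransGen r u v → ReflTransGen r v u →
      ReflTransGen (induced r p) u v) :
    numClasses (induced r p) = (Quotient.mk (mutualReach r) '' {v | p v}).ncard := by
  let f : Quotient (mutualReach (induced r p)) → Quotient (mutualReach r) :=
    Quotient.map Subtype.val fun _ _ h =>
      ⟨reflTransGen_of_induced h.1, reflTransGen_of_induced h.2⟩
  have hf : Function.Injective f := by
    rintro ⟨u⟩ ⟨v⟩ h
    have h' : (mutualReach r).r u v := Quotient.exact h
    exact Quotient.sound ⟨hp u v h'.1 h'.2, hp v u h'.2 h'.1⟩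
  have hr : Set.range f = Quotient.mk (mutualReach r) '' {v | p v} := by
    ext x
    constructor
    · rintro ⟨⟨v⟩, rfl⟩
      exact ⟨v, v.2, rfl⟩
    · rintro ⟨v, hv, rfl⟩
      exact ⟨Quotient.mk _ ⟨v, hv⟩, rfl⟩
  rw [← hr, numClasses, ← Nat.card_range_of_injective hf, Nat.card_coe_set_eq]

theorem NoArrowInto.numClasses_mem {V : Type*} {r : V → V → Prop} {A : Finset V}
    (hA : NoArrowInto r A) :
    numClasses (induced r (· ∈ A)) = (Quotient.mk (mutualReach r) '' A).ncard :=
  numClasses_induced fun _ v h _ => (hA.induced_mem h v.2).2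

/-- A set that no arrow enters is a union of classes, and so is its complement. -/
theorem NoArrowInto.numClasses_add {V : Type*} [Finite V] {r : V → V → Prop} {A : Finset V}
    (hA : NoArrowInto r A) :
    numClasses (induced r (· ∈ A)) + numClasses (induced r (· ∉ A)) = numClasses r := by
  have h2 : numClasses (induced r (· ∉ A)) =
      (Quotient.mk (mutualReach r) '' (A : Set V)ᶜ).ncard :=
    numClasses_induced fun u _ h _ => (hA.induced_notMem h u.2).2
  have hd : Disjoint (Quotient.mk (mutualReach r) '' A)
      (Quotient.mk (mutualReach r) '' (A : Set V)ᶜ) := by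
    rw [Set.disjoint_left]
    rintro _ ⟨u, hu, rfl⟩ ⟨v, hv, h⟩
    have h' : (mutualReach r).r v u := Quotient.exact h
    exact hv (hA.induced_mem h'.1 hu).1
  rw [hA.numClasses_mem, h2, ← Set.ncard_union_eq hd, ← Set.image_union, Set.union_compl_self,
    Set.image_univ, Set.range_eq_univ.2 Quotient.mk_surjective, Set.ncard_univ, numClasses]

theorem StronglyConnectedRel.numClasses_eq_one {V : Type*} {r : V → V → Prop}
    (h : StronglyConnectedRel r) : numClasses r = 1 := by
  obtain ⟨⟨v⟩, h⟩ := h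
  rw [numClasses, Nat.card_eq_one_iff_unique]
  refine ⟨⟨?_⟩, ⟨Quotient.mk _ v⟩⟩
  rintro ⟨a⟩ ⟨b⟩
  exact Quotient.sound ⟨h a b, h b a⟩

theorem reflTransGen_equiv {V W : Type*} {r : V → V → Prop} {s : W → W → Prop} (e : V ≃ W)
    (h : ∀ u v, r u v ↔ s (e u) (e v)) (u v : V) :
    ReflTransGen r u v ↔ ReflTransGen s (e u) (e v) := by
  refine ⟨fun H => H.lift e fun a b => (h a b).1, fun H => ?_⟩
  have := H.lift (p := r) e.symm fun a b hab => by
    show r _ _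
    rw [h]; simpa using hab
  simpa [Function.onFun] using this

theorem numClasses_equiv {V W : Type*} {r : V → V → Prop} {s : W → W → Prop} (e : V ≃ W)
    (h : ∀ u v, r u v ↔ s (e u) (e v)) : numClasses r = numClasses s :=
  Nat.card_congr <| Quotient.congr e fun a b =>
    and_congr (reflTransGen_equiv e h a b) (reflTransGen_equiv e h b a)

theorem symmReach_equiv {V W : Type*} {r : V → V → Prop} {s : W → W → Prop} (e : V ≃ W)
    (h : ∀ u v, r u v ↔ s (e u) (e v)) : SymmReach r ↔ SymmReach s := by
  simp only [SymmReach, reflTransGen_equiv e h, e.surjective.forall]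

theorem stronglyConnectedRel_equiv {V W : Type*} {r : V → V → Prop} {s : W → W → Prop}
    (e : V ≃ W) (h : ∀ u v, r u v ↔ s (e u) (e v)) :
    StronglyConnectedRel r ↔ StronglyConnectedRel s := by
  simp only [StronglyConnectedRel, reflTransGen_equiv e h, e.surjective.forall, e.nonempty_congr]

/-! ### Cancellation over unions of source classes -/

/-- `A` is a union of source classes exactly when no arrow enters `A` and reachability within `A`
is symmetric. Over such `A` the signs cancel, because the source classes of a finite non-empty
relation form a non-empty set. -/
theorem sum_unions_of_sources {V R : Type*} [Fintype V] [Nonempty V] [CommRing R]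
    (r : V → V → Prop) [DecidablePred fun A : Finset V =>
      NoArrowInto r A ∧ SymmReach (induced r (· ∈ A))] :
    ∑ A : Finset V, (if NoArrowInto r A ∧ SymmReach (induced r (· ∈ A)) then
      (-1 : R) ^ numClasses (induced r (· ∈ A)) else 0) = 0 := by
  classical
  let π : V → Quotient (mutualReach r) := Quotient.mk _
  -- the classes from which one can be left only, never entered
  let Q : Finset (Quotient (mutualReach r)) :=
    Finset.univ.filter fun q => ∀ v, π v = q → ∀ u, ReflTransGen r u v → ReflTransGen r v u
  have hQ : Q.Nonempty := by
    -- a vertex with the fewest predecessors lies in a source class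
    obtain ⟨v, -, hv⟩ := Finset.exists_min_image Finset.univ
      (fun v : V => (Finset.univ.filter fun u => ReflTransGen r u v).card) Finset.univ_nonempty
    refine ⟨π v, Finset.mem_filter.2 ⟨Finset.mem_univ _, fun w hw u hu => ?_⟩⟩
    have hw' : (mutualReach r).r w v := Quotient.exact hw
    have huv := hu.trans hw'.1
    have hsub : (Finset.univ.filter fun x => ReflTransGen r x u) ⊆
        Finset.univ.filter fun x => ReflTransGen r x v := fun x hx => by
      simp only [Finset.mem_filter, Finset.mem_univ, true_and] at hx ⊢
      exact hx.trans huv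
    have heq := Finset.eq_of_subset_of_card_le hsub (hv u (Finset.mem_univ _))
    have : v ∈ Finset.univ.filter fun x => ReflTransGen r x u := by
      rw [heq]; simp [ReflTransGen.refl]
    exact hw'.1.trans (Finset.mem_filter.1 this).2
  rw [← Finset.sum_filter]
  have hsum := Finset.sum_powerset_neg_one_pow_card_of_nonempty hQ
  have hsum' : ∑ T ∈ Q.powerset, (-1 : R) ^ T.card = 0 := by
    exact_mod_cast congrArg (Int.cast : ℤ → R) hsum
  rw [← hsum']
  refine Finset.sum_bij' (fun A _ => A.image π) (fun T _ => Finset.univ.filter fun v => π v ∈ T)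
    ?_ ?_ ?_ ?_ ?_
  · intro A hA
    obtain ⟨hA, hS⟩ := (Finset.mem_filter.1 hA).2
    rw [Finset.mem_powerset]
    intro q hq
    obtain ⟨a, ha, rfl⟩ := Finset.mem_image.1 hq
    refine Finset.mem_filter.2 ⟨Finset.mem_univ _, fun w hw u hu => ?_⟩
    have hw' : (mutualReach r).r w a := Quotient.exact hw
    obtain ⟨hwA, -⟩ := hA.induced_mem hw'.1 ha
    obtain ⟨huA, h⟩ := hA.induced_mem hu hwA
    exact reflTransGen_of_induced (hS _ _ h)
  · intro T hT
    rw [Finset.mem_powerset] at hT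
    have key : ∀ u v, ReflTransGen r u v → π v ∈ T → ReflTransGen r v u := fun u v h hv =>
      (Finset.mem_filter.1 (hT hv)).2 v rfl u h
    have hcl : NoArrowInto r (Finset.univ.filter fun v => π v ∈ T) := fun u v h hv => by
      simp only [Finset.mem_filter, Finset.mem_univ, true_and] at hv ⊢
      have : π u = π v := Quotient.sound ⟨.single h, key u v (.single h) hv⟩
      rwa [this]
    refine Finset.mem_filter.2 ⟨Finset.mem_univ _, hcl, fun u v h => ?_⟩
    exact (hcl.induced_mem (key u v (reflTransGen_of_induced h) (Finset.mem_filter.1 v.2).2)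
      u.2).2
  · intro A hA
    obtain ⟨hA, hS⟩ := (Finset.mem_filter.1 hA).2
    ext v
    simp only [Finset.mem_image, Finset.mem_filter, Finset.mem_univ, true_and]
    refine ⟨fun ⟨a, ha, h⟩ => ?_, fun h => ⟨v, h, rfl⟩⟩
    have h' : (mutualReach r).r a v := Quotient.exact h
    exact (hA.induced_mem h'.2 ha).1
  · intro T hT
    ext q
    obtain ⟨v, rfl⟩ := Quotient.mk_surjective q
    simp only [Finset.mem_image, Finset.mem_filter, Finset.mem_univ, true_and]
    exact ⟨fun ⟨a, ha, h⟩ => h ▸ ha, fun h => ⟨v, h, rfl⟩⟩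
  · intro A hA
    obtain ⟨hA, -⟩ := (Finset.mem_filter.1 hA).2
    rw [hA.numClasses_mem, ← Set.ncard_coe_finset, Finset.coe_image]

/-! ### Decomposing a digraph along a set of vertices -/

/-- The digraphs without loops on the vertex type `V`; for `V = Fin n` these are the labelled
digraphs on `n` vertices. -/
abbrev LoopfreeDigraph (V : Type*) : Type _ :=
  {G : Digraph V // ∀ v, ¬ G.Adj v v}

noncomputable instance (V : Type*) [Finite V] : Fintype (LoopfreeDigraph V) :=
  haveI : Finite (LoopfreeDigraph V) :=
    Finite.of_injective (fun G => G.1.Adj) fun _ _ h => Subtype.ext (Digraph.ext h)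
  Fintype.ofFinite _

/-- Relabelling the vertices. -/
def LoopfreeDigraph.relabel {V W : Type*} (e : V ≃ W) : LoopfreeDigraph V ≃ LoopfreeDigraph W where
  toFun G := ⟨⟨fun a b => G.1.Adj (e.symm a) (e.symm b)⟩, fun _ => G.2 _⟩
  invFun G := ⟨⟨fun a b => G.1.Adj (e a) (e b)⟩, fun _ => G.2 _⟩
  left_inv G := by ext; simp
  right_inv G := by ext; simp

/-- The digraph induced on the vertices satisfying `p`. -/
def LoopfreeDigraph.restrict {V : Type*} (G : LoopfreeDigraph V) (p : V → Prop) :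
    LoopfreeDigraph (Subtype p) :=
  ⟨⟨induced G.1.Adj p⟩, fun _ => G.2 _⟩

@[simp]
theorem LoopfreeDigraph.restrict_adj {V : Type*} (G : LoopfreeDigraph V) (p : V → Prop) :
    (G.restrict p).1.Adj = induced G.1.Adj p :=
  rfl

/-- A digraph with no arrow into `A` consists of a digraph on `A`, a digraph on the complement,
and an arbitrary set of arrows from `A` to the complement. -/
def LoopfreeDigraph.splitEquiv {V : Type*} [DecidableEq V] (A : Finset V) :
    {G : LoopfreeDigraph V // NoArrowInto G.1.Adj A} ≃
      (LoopfreeDigraph {v // v ∈ A} × LoopfreeDigraph {v // v ∉ A}) ×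
        ({v // v ∈ A} → {v // v ∉ A} → Prop) where
  toFun G := ((G.1.restrict (· ∈ A), G.1.restrict (· ∉ A)), fun u v => G.1.1.Adj u v)
  invFun x := ⟨⟨⟨fun u v =>
      if hu : u ∈ A then
        if hv : v ∈ A then x.1.1.1.Adj ⟨u, hu⟩ ⟨v, hv⟩ else x.2 ⟨u, hu⟩ ⟨v, hv⟩
      else if hv : v ∈ A then False else x.1.2.1.Adj ⟨u, hu⟩ ⟨v, hv⟩⟩,
    fun v => by
      by_cases hv : v ∈ A
      · simpa [hv] using x.1.1.2 _
      · simpa [hv] using x.1.2.2 _⟩,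
    fun u v h hv => by
      by_contra hu
      simp [hu, hv] at h⟩
  left_inv G := by
    ext u v
    by_cases hu : u ∈ A <;> by_cases hv : v ∈ A <;> simp [hu, hv, LoopfreeDigraph.restrict, induced]
    exact fun h => hu (G.2 u v h hv)
  right_inv x := by
    refine Prod.ext (Prod.ext ?_ ?_) ?_
    · ext ⟨u, hu⟩ ⟨v, hv⟩
      simp [hu, hv, LoopfreeDigraph.restrict, induced]
    · ext ⟨u, hu⟩ ⟨v, hv⟩
      simp [hu, hv, LoopfreeDigraph.restrict, induced]
    · ext ⟨u, hu⟩ ⟨v, hv⟩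
      simp [hu, hv]

open scoped Classical in
/-- Summation over the digraphs with no arrow into `A`, in terms of the three parts. -/
theorem LoopfreeDigraph.sum_noArrowInto {V R : Type*} [Fintype V] [CommRing R] (A : Finset V)
    (f : LoopfreeDigraph {v // v ∈ A} → LoopfreeDigraph {v // v ∉ A} →
      ({v // v ∈ A} → {v // v ∉ A} → Prop) → R) :
    ∑ G : LoopfreeDigraph V, (if NoArrowInto G.1.Adj A then
        f (G.restrict (· ∈ A)) (G.restrict (· ∉ A)) (fun u v => G.1.Adj u v) else 0) =
      ∑ H, ∑ H', ∑ K, f H H' K := by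
  rw [← Finset.sum_filter, ← Finset.sum_subtype_eq_sum_filter]
  rw [show (Finset.univ.subtype fun G : LoopfreeDigraph V => NoArrowInto G.1.Adj A) =
    Finset.univ by ext; simp]
  refine (Fintype.sum_equiv (LoopfreeDigraph.splitEquiv A) _ (fun x => f x.1.1 x.1.2 x.2)
    fun _ => rfl).trans ?_
  rw [Fintype.sum_prod_type, Fintype.sum_prod_type]

/-! ### Weighted sums over digraphs -/

/-- The sum of `t ^ scc` over the digraphs on `V`, where `scc` is the number of strongly connected
components. -/
noncomputable def digraphSum (V : Type*) [Finite V] {R : Type*} [CommRing R] (t : R) : R :=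
  ∑ G : LoopfreeDigraph V, t ^ numClasses G.1.Adj

open scoped Classical in
/-- The sum of `t ^ (number of components)` over the disjoint unions of strongly connected
digraphs on `V`. -/
noncomputable def symmSum (V : Type*) [Finite V] {R : Type*} [CommRing R] (t : R) : R :=
  ∑ G : LoopfreeDigraph V, if SymmReach G.1.Adj then t ^ numClasses G.1.Adj else 0

open scoped Classical in
/-- The number of strongly connected digraphs on `V`, in the ring `R`. -/
noncomputable def strongSum (V : Type*) [Finite V] (R : Type*) [CommRing R] : R :=
  ∑ G : LoopfreeDigraph V, if StronglyConnectedRel G.1.Adj then 1 else 0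

theorem digraphSum_congr {V W R : Type*} [Finite V] [Finite W] [CommRing R] (e : V ≃ W) (t : R) :
    digraphSum V t = digraphSum W t :=
  Fintype.sum_equiv (LoopfreeDigraph.relabel e) _ _ fun G => by
    rw [numClasses_equiv e (s := (LoopfreeDigraph.relabel e G).1.Adj)]
    simp [LoopfreeDigraph.relabel]

theorem symmSum_congr {V W R : Type*} [Finite V] [Finite W] [CommRing R] (e : V ≃ W) (t : R) :
    symmSum V t = symmSum W t :=
  Fintype.sum_equiv (LoopfreeDigraph.relabel e) _ _ fun G => by
    have h : ∀ u v, G.1.Adj u v ↔ (LoopfreeDigraph.relabel e G).1.Adj (e u) (e v) := by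
      simp [LoopfreeDigraph.relabel]
    rw [numClasses_equiv e h, symmReach_equiv e h]

theorem strongSum_congr {V W : Type*} (R : Type*) [Finite V] [Finite W] [CommRing R]
    (e : V ≃ W) : strongSum V R = strongSum W R :=
  Fintype.sum_equiv (LoopfreeDigraph.relabel e) _ _ fun G => by
    have h : ∀ u v, G.1.Adj u v ↔ (LoopfreeDigraph.relabel e G).1.Adj (e u) (e v) := by
      simp [LoopfreeDigraph.relabel]
    rw [stronglyConnectedRel_equiv e h]

/-- Choosing a union `A` of source classes in a digraph, with sign according to the number of its
classes, amounts to choosing a disjoint union of strongly connected digraphs on `A`, a digraph on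
the complement, and arrows from `A` to the complement. The alternating sum over `A` vanishes for each
digraph separately. -/
theorem sum_symmSum_mul_digraphSum {V R : Type*} [Fintype V] [DecidableEq V]
    [Nonempty V] [CommRing R] (t : R) :
    ∑ A : Finset V, (2 : R) ^ (A.card * Aᶜ.card) *
      (symmSum {v // v ∈ A} (-t) * digraphSum {v // v ∉ A} t) = 0 := by
  classical
  have h1 : ∀ A : Finset V, (2 : R) ^ (A.card * Aᶜ.card) *
      (symmSum {v // v ∈ A} (-t) * digraphSum {v // v ∉ A} t) =
      ∑ G : LoopfreeDigraph V, t ^ numClasses G.1.Adj *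
        (if NoArrowInto G.1.Adj A ∧ SymmReach (induced G.1.Adj (· ∈ A)) then
          (-1 : R) ^ numClasses (induced G.1.Adj (· ∈ A)) else 0) := by
    intro A
    have h2 := LoopfreeDigraph.sum_noArrowInto A fun H H' _ =>
      (if SymmReach H.1.Adj then (-t) ^ numClasses H.1.Adj else 0) * t ^ numClasses H'.1.Adj
    have hK : Nat.card ({v // v ∈ A} → {v // v ∉ A} → Prop) = 2 ^ (A.card * Aᶜ.card) := by
      rw [Nat.card_eq_fintype_card, Fintype.card_fun, Fintype.card_fun, Fintype.card_prop,
        ← pow_mul, mul_comm, Fintype.card_coe, Fintype.card_subtype_compl, Fintype.card_coe, Finset.card_compl]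
    simp only [Finset.sum_const, Finset.card_univ, ← Nat.card_eq_fintype_card, hK,
      nsmul_eq_mul] at h2
    rw [symmSum, digraphSum, Finset.sum_mul_sum, Finset.mul_sum]
    simp only [Finset.mul_sum]
    push_cast at h2
    rw [← h2]
    refine Finset.sum_congr rfl fun G _ => ?_
    by_cases hA : NoArrowInto G.1.Adj A
    · by_cases hS : SymmReach (induced G.1.Adj (· ∈ A))
      · simp only [hA, hS, and_self, if_true, LoopfreeDigraph.restrict_adj]
        rw [← hA.numClasses_add, neg_pow, pow_add]
        ring
      · simp [hS]
    · simp [hA]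
  rw [Finset.sum_congr rfl fun A _ => h1 A, Finset.sum_comm]
  refine Finset.sum_eq_zero fun G _ => ?_
  rw [← Finset.mul_sum, sum_unions_of_sources, mul_zero]

/-- For symmetric reachability, being the class of a point is a condition on the three parts of
the decomposition along `A`. -/
theorem symmReach_and_isClass_iff {V : Type*} [Fintype V] [DecidableEq V] {r : V → V → Prop}
    {A : Finset V} :
    (SymmReach r ∧ ∃ v, ∀ u, u ∈ A ↔ ReflTransGen r v u) ↔
      NoArrowInto r A ∧ (∀ u ∈ A, ∀ v ∉ A, ¬ r u v) ∧
        StronglyConnectedRel (induced r (· ∈ A)) ∧ SymmReach (induced r (· ∉ A)) := by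
  constructor
  · rintro ⟨hS, v, hv⟩
    have hA : NoArrowInto r A := fun a b hab hb =>
      (hv a).2 (((hv b).1 hb).trans (hS _ _ (.single hab)))
    refine ⟨hA, fun a ha b hb hab => hb ((hv b).2 (((hv a).1 ha).tail hab)),
      ⟨⟨v, (hv v).2 .refl⟩, fun a b => ?_⟩, fun a b hab => ?_⟩
    · exact (hA.induced_mem ((hS _ _ ((hv a).1 a.2)).trans ((hv b).1 b.2)) b.2).2
    · exact (hA.induced_notMem (hS _ _ (reflTransGen_of_induced hab)) b.2).2
  · rintro ⟨hA, hK, ⟨⟨v⟩, hH⟩, hH'⟩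
    have hA' : NoArrowInto r Aᶜ := fun a b hab hb => by
      rw [Finset.mem_compl] at hb ⊢
      exact fun ha => hK a ha b hb hab
    refine ⟨fun a b hab => ?_, v, fun u => ⟨fun hu => reflTransGen_of_induced (hH v ⟨u, hu⟩),
      fun hu => ?_⟩⟩
    · by_cases hb : b ∈ A
      · obtain ⟨ha, -⟩ := hA.induced_mem hab hb
        exact reflTransGen_of_induced (hH ⟨b, hb⟩ ⟨a, ha⟩)
      · obtain ⟨ha, -⟩ := hA'.induced_mem hab (Finset.mem_compl.2 hb)
        obtain ⟨_, h⟩ := hA.induced_notMem hab (Finset.mem_compl.1 ha)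
        exact reflTransGen_of_induced (hH' _ _ h)
    · by_contra h
      exact Finset.mem_compl.1 (hA'.induced_mem hu (Finset.mem_compl.2 h)).1 v.2

/-- The sizes of the classes add up to the number of points. -/
theorem sum_card_isClass {V : Type*} [Fintype V] {r : V → V → Prop} (hr : SymmReach r)
    [DecidablePred fun A : Finset V => ∃ v, ∀ u, u ∈ A ↔ ReflTransGen r v u] :
    ∑ A : Finset V, (if ∃ v, ∀ u, u ∈ A ↔ ReflTransGen r v u then A.card else 0) =
      Fintype.card V := by
  classical
  rw [← Finset.card_univ, Finset.card_eq_sum_card_fiberwise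
    (f := fun v => Finset.univ.filter fun u => ReflTransGen r v u) (t := Finset.univ)
    (fun _ _ => by simp)]
  refine Finset.sum_congr rfl fun A _ => ?_
  split_ifs with h
  · obtain ⟨v, hv⟩ := h
    congr 1
    ext a
    simp only [Finset.mem_filter, Finset.mem_univ, true_and, Finset.ext_iff, hv]
    exact ⟨fun ha u => ⟨fun hu => ha.trans hu, fun hu => (hr _ _ ha).trans hu⟩,
      fun H => (H a).1 .refl⟩
  · symm
    rw [Finset.card_eq_zero, Finset.filter_eq_empty_iff]
    rintro v - rfl
    exact h ⟨v, by simp⟩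

open scoped Classical in
/-- Marking a vertex of a disjoint union of strongly connected digraphs singles out the component
`A` that contains it. -/
theorem card_mul_symmSum {V R : Type*} [Fintype V] [CommRing R] (t : R) :
    (Fintype.card V : R) * symmSum V t = ∑ A : Finset V, (A.card : R) *
      (strongSum {v // v ∈ A} R * (t * symmSum {v // v ∉ A} t)) := by
  have h1 : ∀ A : Finset V, strongSum {v // v ∈ A} R * (t * symmSum {v // v ∉ A} t) =
      ∑ G : LoopfreeDigraph V,
        if SymmReach G.1.Adj ∧ ∃ v, ∀ u, u ∈ A ↔ ReflTransGen G.1.Adj v u then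
          t ^ numClasses G.1.Adj else 0 := by
    intro A
    have h2 := LoopfreeDigraph.sum_noArrowInto A fun H H' K =>
      if K = fun _ _ => False then (if StronglyConnectedRel H.1.Adj then (1 : R) else 0) *
        (t * if SymmReach H'.1.Adj then t ^ numClasses H'.1.Adj else 0) else 0
    simp only [Finset.sum_ite_eq', Finset.mem_univ, if_true] at h2
    rw [strongSum, symmSum, Finset.mul_sum, Finset.sum_mul_sum, ← h2]
    refine Finset.sum_congr rfl fun G _ => ?_
    have hK : ((fun (u : {v // v ∈ A}) (v : {v // v ∉ A}) => G.1.Adj u v) = fun _ _ => False) ↔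
        ∀ u ∈ A, ∀ v ∉ A, ¬ G.1.Adj u v := by
      simp [funext_iff]
    simp only [hK, LoopfreeDigraph.restrict_adj, symmReach_and_isClass_iff]
    by_cases hA : NoArrowInto G.1.Adj A
    · by_cases hH : StronglyConnectedRel (induced G.1.Adj (· ∈ A))
      · simp only [hA, hH, true_and, if_true, ← hA.numClasses_add, hH.numClasses_eq_one,
          pow_add, pow_one, one_mul, ite_and]
        by_cases hS : SymmReach (induced G.1.Adj (· ∉ A)) <;> simp [hS]
      · simp [hH]
    · simp [hA]
  simp only [h1, Finset.mul_sum]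
  rw [Finset.sum_comm, symmSum, Finset.mul_sum]
  refine Finset.sum_congr rfl fun G _ => ?_
  by_cases hS : SymmReach G.1.Adj
  · simp only [hS, true_and, if_true]
    rw [← sum_card_isClass hS, Nat.cast_sum, Finset.sum_mul]
    refine Finset.sum_congr rfl fun A _ => ?_
    split_ifs <;> simp
  · simp [hS]

/-! ### Numerical recurrences -/

theorem sum_finset_card {R : Type*} [CommRing R] (n : ℕ) (f : ℕ → ℕ → R) :
    ∑ A : Finset (Fin n), f A.card Aᶜ.card =
      ∑ p ∈ Finset.HasAntidiagonal.antidiagonal n, (n.choose p.1 : R) * f p.1 p.2 := by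
  rw [Finset.Nat.sum_antidiagonal_eq_sum_range_succ (fun i j => (n.choose i : R) * f i j)]
  have h := Finset.sum_powerset_apply_card (fun m => f m (n - m))
    (x := (Finset.univ : Finset (Fin n)))
  simp only [Finset.powerset_univ, Finset.card_univ, Fintype.card_fin, nsmul_eq_mul] at h
  rw [← h]
  simp [Finset.card_compl]

theorem sum_antidiagonal_symmSum_mul_digraphSum {R : Type*} [CommRing R] (t : R) {n : ℕ}
    (hn : n ≠ 0) :
    ∑ p ∈ Finset.HasAntidiagonal.antidiagonal n, (n.choose p.1 : R) *
      (2 ^ (p.1 * p.2) * (symmSum (Fin p.1) (-t) * digraphSum (Fin p.2) t)) = 0 := by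
  have : Nonempty (Fin n) := Fin.pos_iff_nonempty.1 (Nat.pos_of_ne_zero hn)
  rw [← sum_finset_card n fun i j => 2 ^ (i * j) * (symmSum (Fin i) (-t) * digraphSum (Fin j) t),
    ← sum_symmSum_mul_digraphSum (V := Fin n) t]
  refine Finset.sum_congr rfl fun A _ => ?_
  rw [symmSum_congr (A.equivFin) (-t), digraphSum_congr (W := Fin Aᶜ.card)
    ((Equiv.subtypeEquivRight fun v => by simp).trans Aᶜ.equivFin) t]

theorem natCast_mul_symmSum {R : Type*} [CommRing R] (t : R) (n : ℕ) :
    (n : R) * symmSum (Fin n) t = ∑ p ∈ Finset.HasAntidiagonal.antidiagonal n, (n.choose p.1 : R) *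
      ((p.1 : R) * (strongSum (Fin p.1) R * (t * symmSum (Fin p.2) t))) := by
  have h := card_mul_symmSum (V := Fin n) t
  rw [Fintype.card_fin] at h
  rw [h, ← sum_finset_card n fun i j =>
    (i : R) * (strongSum (Fin i) R * (t * symmSum (Fin j) t))]
  refine Finset.sum_congr rfl fun A _ => ?_
  rw [strongSum_congr R A.equivFin, symmSum_congr (W := Fin Aᶜ.card)
    ((Equiv.subtypeEquivRight fun v => by simp).trans Aᶜ.equivFin) t]

theorem choose_two_add (a b : ℕ) : (a + b).choose 2 = a.choose 2 + b.choose 2 + a * b := by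
  induction b with
  | zero => simp
  | succ b ih =>
    have h1 := Nat.choose_succ_succ' (a + b) 1
    have h2 := Nat.choose_succ_succ' b 1
    simp only [Nat.choose_one_right] at h1 h2
    rw [← add_assoc, h1, h2, ih]
    ring

/-! ### The exponential generating function of unions of strongly connected digraphs -/

/-- Labelled digraphs on `n` vertices are the digraphs without loops on `Fin n`. -/
def labelledDigraphEquiv (n : ℕ) : LabelledDigraph n ≃ LoopfreeDigraph (Fin n) :=
  Equiv.refl _

theorem strongSum_fin (R : Type*) [CommRing R] (n : ℕ) :
    strongSum (Fin n) R = (numStrong n : R) := by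
  classical
  rw [numStrong, Nat.card_eq_fintype_card, Fintype.card_subtype, ← Finset.sum_boole]
  refine (Fintype.sum_equiv (labelledDigraphEquiv n) _ _ fun G => ?_).symm
  have h : G.IsStronglyConnected ↔ StronglyConnectedRel (labelledDigraphEquiv n G).1.Adj :=
    and_congr Fin.pos_iff_nonempty Iff.rfl
  simp only [h]

theorem numClasses_of_isEmpty {V : Type*} [IsEmpty V] (r : V → V → Prop) : numClasses r = 0 :=
  haveI : IsEmpty (Quotient (mutualReach r)) := ⟨fun q => isEmptyElim q.out⟩
  Nat.card_of_isEmpty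

theorem symmSum_of_isEmpty {V R : Type*} [Finite V] [IsEmpty V] [CommRing R] (t : R) :
    symmSum V t = 1 := by
  classical
  have : Subsingleton (LoopfreeDigraph V) :=
    ⟨fun G H => Subtype.ext (Digraph.ext (Subsingleton.elim _ _))⟩
  rw [symmSum, Fintype.sum_subsingleton _ ⟨⟨fun _ _ => False⟩, fun _ h => h⟩,
    if_pos (show SymmReach _ from fun u => isEmptyElim u), numClasses_of_isEmpty, pow_zero]

theorem digraphSum_of_isEmpty {V R : Type*} [Finite V] [IsEmpty V] [CommRing R] (t : R) :
    digraphSum V t = 1 := by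
  have : Subsingleton (LoopfreeDigraph V) :=
    ⟨fun G H => Subtype.ext (Digraph.ext (Subsingleton.elim _ _))⟩
  rw [digraphSum, Fintype.sum_subsingleton _ ⟨⟨fun _ _ => False⟩, fun _ h => h⟩,
    numClasses_of_isEmpty, pow_zero]

/-- A sequence satisfying the recurrence `n cₙ = ∑ i gᵢ cⱼ`, the sum being over `i + j = n`, is
determined by its initial value. -/
theorem eq_of_natCast_mul_eq_sum {R : Type*} [CommRing R] [IsDomain R] [CharZero R]
    {g c d : ℕ → R}
    (hc : ∀ n : ℕ, (n : R) * c n =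
      ∑ p ∈ Finset.HasAntidiagonal.antidiagonal n, (p.1 : R) * g p.1 * c p.2)
    (hd : ∀ n : ℕ, (n : R) * d n =
      ∑ p ∈ Finset.HasAntidiagonal.antidiagonal n, (p.1 : R) * g p.1 * d p.2)
    (h0 : c 0 = d 0) (n : ℕ) : c n = d n := by
  induction n using Nat.strong_induction_on with
  | _ n ih =>
    rcases Nat.eq_zero_or_pos n with rfl | hn
    · exact h0
    · refine mul_left_cancel₀ (Nat.cast_ne_zero.2 hn.ne' : (n : R) ≠ 0) ?_
      rw [hc, hd]
      refine Finset.sum_congr rfl fun p hp => ?_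
      rcases Nat.eq_zero_or_pos p.1 with h | h
      · simp [h]
      · rw [ih p.2 (by have := Finset.HasAntidiagonal.mem_antidiagonal.1 hp; omega)]

theorem coeff_X_mul_derivative {R : Type*} [CommRing R] (f : R⟦X⟧) (n : ℕ) :
    PowerSeries.coeff n (PowerSeries.X * PowerSeries.derivative R f) =
      (n : R) * PowerSeries.coeff n f := by
  cases n with
  | zero => simp
  | succ n =>
    rw [PowerSeries.coeff_succ_X_mul, PowerSeries.coeff_derivative]
    push_cast
    ring

theorem coeff_negTSCD (n : ℕ) : PowerSeries.coeff n negTSCD =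
    -Polynomial.X * Polynomial.C ((numStrong n : ℚ) / n !) := by
  simp [negTSCD, liftT, SCD, exponentialGF]

/-- The exponential formula: both sides satisfy the recurrence expressing
`z F' = z (-t SCD)' F`. -/
theorem coeff_expNegTSCD (n : ℕ) : PowerSeries.coeff n expNegTSCD =
    Polynomial.C (1 / (n ! : ℚ)) * symmSum (Fin n) (-Polynomial.X : Polynomial ℚ) := by
  refine eq_of_natCast_mul_eq_sum (g := fun k => PowerSeries.coeff k negTSCD)
    (c := fun n => PowerSeries.coeff n expNegTSCD)
    (d := fun n => Polynomial.C (1 / (n ! : ℚ)) * symmSum (Fin n) (-Polynomial.X : Polynomial ℚ))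
    (fun n => ?_) (fun n => ?_) ?_ n
  · rw [← coeff_X_mul_derivative, expNegTSCD, PowerSeries.derivative_subst hasSubst_negTSCD,
      PowerSeries.derivative_exp, mul_left_comm, mul_comm, PowerSeries.coeff_mul]
    exact Finset.sum_congr rfl fun p _ => by rw [coeff_X_mul_derivative]
  · rw [mul_left_comm, natCast_mul_symmSum, Finset.mul_sum]
    refine Finset.sum_congr rfl fun p hp => ?_
    obtain ⟨i, j⟩ := p
    obtain rfl : i + j = n := Finset.HasAntidiagonal.mem_antidiagonal.1 hp
    dsimp only
    have h : (1 / ((i + j)! : ℚ)) * ((i + j).choose i : ℚ) = 1 / (i ! : ℚ) * (1 / (j ! : ℚ)) := by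
      rw [Nat.cast_add_choose]
      field_simp
    have h' := congrArg (Polynomial.C : ℚ → Polynomial ℚ) h
    simp only [map_mul, map_natCast] at h'
    rw [coeff_negTSCD, strongSum_fin, div_eq_mul_one_div (numStrong i : ℚ), map_mul, map_natCast]
    linear_combination (i : Polynomial ℚ) * (numStrong i : Polynomial ℚ) *
      (-Polynomial.X * symmSum (Fin j) (-Polynomial.X : Polynomial ℚ)) * h'
  · have h0 : numStrong 0 = 0 :=
      haveI : IsEmpty {G : LabelledDigraph 0 // G.IsStronglyConnected} :=
        ⟨fun G => lt_irrefl 0 G.2.1⟩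
      Nat.card_of_isEmpty
    have h1 : PowerSeries.constantCoeff negTSCD = 0 := by
      rw [← PowerSeries.coeff_zero_eq_constantCoeff_apply, coeff_negTSCD, h0]
      simp
    rw [symmSum_of_isEmpty, expNegTSCD, PowerSeries.coeff_subst' hasSubst_negTSCD,
      finsum_eq_single _ 0 fun d hd => by simp [h1, hd]]
    simp

theorem coeff_graphicD (n : ℕ) : PowerSeries.coeff n graphicD =
    Polynomial.C (1 / ((2 : ℚ) ^ n.choose 2 * (n ! : ℚ))) *
      digraphSum (Fin n) (Polynomial.X : Polynomial ℚ) := by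
  rw [graphicD, PowerSeries.coeff_mk, digraphSum]
  exact congrArg _ (Fintype.sum_equiv (labelledDigraphEquiv n) _ _ fun _ => rfl)

theorem expHadamard_mul_graphicD :
    expHadamard expNegTSCD (liftT graphicSet) * graphicD = 1 := by
  ext1 n
  have hterm : ∀ p ∈ Finset.HasAntidiagonal.antidiagonal n,
      PowerSeries.coeff p.1 (expHadamard expNegTSCD (liftT graphicSet)) *
        PowerSeries.coeff p.2 graphicD =
      Polynomial.C (1 / ((2 : ℚ) ^ n.choose 2 * (n ! : ℚ))) *
        ((n.choose p.1 : Polynomial ℚ) * (2 ^ (p.1 * p.2) *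
          (symmSum (Fin p.1) (-Polynomial.X : Polynomial ℚ) *
            digraphSum (Fin p.2) (Polynomial.X : Polynomial ℚ)))) := by
    rintro ⟨i, j⟩ hp
    obtain rfl : i + j = n := Finset.HasAntidiagonal.mem_antidiagonal.1 hp
    have h : (i ! : ℚ) * (1 / (i ! : ℚ)) * (1 / ((2 : ℚ) ^ i.choose 2 * (i ! : ℚ))) *
        (1 / ((2 : ℚ) ^ j.choose 2 * (j ! : ℚ))) =
        1 / ((2 : ℚ) ^ (i + j).choose 2 * ((i + j)! : ℚ)) *
          (((i + j).choose i : ℚ) * 2 ^ (i * j)) := by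
      rw [Nat.cast_add_choose, choose_two_add, pow_add, pow_add]
      field_simp
    have h' := congrArg (Polynomial.C : ℚ → Polynomial ℚ) h
    simp only [map_mul, map_natCast, map_pow, map_ofNat] at h'
    dsimp only
    rw [expHadamard, PowerSeries.coeff_mk, coeff_expNegTSCD, coeff_graphicD, liftT,
      PowerSeries.coeff_map, graphicSet, graphicGF, PowerSeries.coeff_mk, Nat.cast_one]
    linear_combination symmSum (Fin i) (-Polynomial.X : Polynomial ℚ) *
            digraphSum (Fin j) (Polynomial.X : Polynomial ℚ) * h'
  rw [PowerSeries.coeff_mul, Finset.sum_congr rfl hterm, ← Finset.mul_sum]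
  rcases Nat.eq_zero_or_pos n with rfl | hn
  · simp [symmSum_of_isEmpty, digraphSum_of_isEmpty]
  · rw [sum_antidiagonal_symmSum_mul_digraphSum _ hn.ne', PowerSeries.coeff_one,
      if_neg hn.ne', mul_zero]

/-! ### Extracting powers of the component-marking variable -/

theorem graphicS_eq_coeffT (m : ℕ) : graphicS m = coeffT m graphicD := by
  classical
  ext n
  have h : (numWithSCC m n : ℚ) =
      ∑ G : LabelledDigraph n, (Polynomial.X ^ G.numSCC : Polynomial ℚ).coeff m := by
    rw [numWithSCC, Nat.card_eq_fintype_card, Fintype.card_subtype, ← Finset.sum_boole]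
    simp only [Polynomial.coeff_X_pow, eq_comm]
  rw [graphicS, graphicGF, coeffT, graphicD, PowerSeries.coeff_mk, PowerSeries.coeff_mk,
    PowerSeries.coeff_mk, Polynomial.coeff_C_mul, Polynomial.finsetSum_coeff, ← h]
  ring

/-- Exchanging the two variables: a series in `z` over `ℚ[t]` as a series in `t` over `ℚ⟦z⟧`. -/
noncomputable def swapVars (F : (Polynomial ℚ)⟦X⟧) : (ℚ⟦X⟧)⟦X⟧ :=
  PowerSeries.mk fun m => coeffT m F

theorem swapVars_mul (F G : (Polynomial ℚ)⟦X⟧) : swapVars (F * G) = swapVars F * swapVars G := by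
  ext m n
  simp only [swapVars, PowerSeries.coeff_mk, coeffT, PowerSeries.coeff_mul, map_sum,
    Polynomial.finsetSum_coeff, Polynomial.coeff_mul]
  exact Finset.sum_comm

theorem swapVars_one : swapVars 1 = 1 := by
  ext m n
  rcases eq_or_ne m 0 with rfl | hm <;> rcases eq_or_ne n 0 with rfl | hn <;>
    simp [swapVars, coeffT, PowerSeries.coeff_one, Polynomial.coeff_one, *]

theorem coeffT_expNegTSCD (m : ℕ) :
    coeffT m expNegTSCD = ((-1 : ℚ) ^ m / (m ! : ℚ)) • SCD ^ m := by
  ext n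
  have hpow : ∀ d, PowerSeries.coeff n (negTSCD ^ d) =
      Polynomial.C ((-1) ^ d * PowerSeries.coeff n (SCD ^ d)) * Polynomial.X ^ d := by
    intro d
    have h : negTSCD = PowerSeries.C (-Polynomial.X) * PowerSeries.map Polynomial.C SCD := by
      simp [negTSCD, liftT]
    rw [h, mul_pow, ← map_pow, ← map_pow (PowerSeries.map _), PowerSeries.coeff_C_mul,
      PowerSeries.coeff_map, neg_pow, map_mul, map_pow Polynomial.C, map_neg, map_one]
    ring
  have hfin := PowerSeries.coeff_subst_finite' hasSubst_negTSCD
    (PowerSeries.exp (Polynomial ℚ)) n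
  rw [coeffT, PowerSeries.coeff_mk, expNegTSCD, PowerSeries.coeff_subst' hasSubst_negTSCD]
  refine ((Polynomial.lcoeff ℚ m).toAddMonoidHom.map_finsum hfin).trans ?_
  have hterm : ∀ d, (Polynomial.lcoeff ℚ m).toAddMonoidHom
      (PowerSeries.coeff d (PowerSeries.exp (Polynomial ℚ)) •
        PowerSeries.coeff n (negTSCD ^ d)) =
      if m = d then 1 / (d ! : ℚ) * ((-1) ^ d * PowerSeries.coeff n (SCD ^ d)) else 0 := by
    intro d
    rw [hpow, PowerSeries.coeff_exp, smul_eq_mul, Polynomial.algebraMap_eq, ← mul_assoc, ← map_mul]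
    refine (Polynomial.coeff_C_mul_X_pow _ _ _).trans ?_
    rfl
  simp only [hterm]
  rw [finsum_eq_single _ m fun d hd => if_neg hd.symm, if_pos rfl, map_smul, smul_eq_mul]
  ring

/-! ### Bell polynomials and reciprocal series -/

/-- The coefficients of the powers of `∑ yᵢ tⁱ / i!` are given by Bell polynomials. Only the
terms with `i ≤ m` matter for the coefficient of `t ^ m`. -/
theorem coeff_sum_pow_eq_aeval_bellPolynomial {A : Type*} [CommRing A] [Algebra ℚ A] (m k : ℕ)
    (y : ℕ → A) :
    PowerSeries.coeff m ((∑ i : Fin m, PowerSeries.C ((1 / (((i : ℕ) + 1)! : ℚ)) • y (i + 1)) *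
      PowerSeries.X ^ ((i : ℕ) + 1)) ^ k) =
      ((k ! : ℚ) / (m ! : ℚ)) •
        MvPolynomial.aeval (fun i : Fin m => y (i + 1)) (bellPolynomial m k) := by
  rw [Finset.sum_pow_eq_sum_piAntidiag, map_sum, bellPolynomial, map_sum, Finset.smul_sum]
  have hsub : bellIndices m k ⊆ Finset.univ.piAntidiag k := fun j hj => by
    rw [Finset.mem_piAntidiag]
    exact ⟨(mem_bellIndices.1 hj).1, fun _ _ => Finset.mem_univ _⟩
  have hterm : ∀ j : Fin m → ℕ, PowerSeries.coeff m ((Nat.multinomial Finset.univ j : A⟦X⟧) *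
      ∏ i : Fin m, (PowerSeries.C ((1 / (((i : ℕ) + 1)! : ℚ)) • y (i + 1)) *
        PowerSeries.X ^ ((i : ℕ) + 1)) ^ j i) =
      if m = ∑ i : Fin m, ((i : ℕ) + 1) * j i then (Nat.multinomial Finset.univ j : A) *
        ∏ i : Fin m, ((1 / (((i : ℕ) + 1)! : ℚ)) • y (i + 1)) ^ j i else 0 := by
    intro j
    simp only [mul_pow, ← pow_mul, Finset.prod_mul_distrib, Finset.prod_pow_eq_pow_sum, ← map_pow,
      ← map_prod]
    rw [← mul_assoc, ← map_natCast (PowerSeries.C (R := A)), ← map_mul, PowerSeries.coeff_C_mul,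
      PowerSeries.coeff_X_pow, mul_ite, mul_one, mul_zero]
  symm
  refine Finset.sum_subset_zero_on_sdiff hsub (fun j hj => ?_) (fun j hj => ?_)
  · rw [Finset.mem_sdiff, mem_bellIndices, Finset.mem_piAntidiag] at hj
    rw [hterm, if_neg fun h => hj.2 ⟨hj.1.1, h.symm⟩]
  · obtain ⟨hk, hm⟩ := mem_bellIndices.1 hj
    rw [hterm, if_pos hm.symm]
    have hmult : (Nat.multinomial Finset.univ j : ℚ) = (k ! : ℚ) / ∏ i : Fin m, ((j i)! : ℚ) := by
      have h := Nat.multinomial_spec Finset.univ j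
      rw [hk] at h
      rw [eq_div_iff (Finset.prod_ne_zero_iff.2 fun i _ => by positivity), ← h]
      push_cast
      ring
    rw [← map_natCast (algebraMap ℚ A), hmult]
    simp only [map_mul, map_prod, map_pow, MvPolynomial.aeval_X, MvPolynomial.algHom_C,
      Algebra.smul_def, mul_pow, Finset.prod_mul_distrib]
    simp only [← map_pow, ← map_prod, ← mul_assoc, ← map_mul]
    congr 3
    have : (m ! : ℚ) ≠ 0 := by positivity
    field_simp

/-- If `P = 1 + ∑ xᵢ tⁱ / i!`, the coefficients of `1 / P = ∑ (1 - P)ᵏ` are alternating sums of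
Bell polynomials. -/
theorem coeff_of_mk_mul_eq_one {A : Type*} [CommRing A] [Algebra ℚ A] {x : ℕ → A} (hx : x 0 = 1)
    {Q : A⟦X⟧} (hQ : (PowerSeries.mk fun i => (1 / (i ! : ℚ)) • x i) * Q = 1) {m : ℕ}
    (hm : 1 ≤ m) :
    PowerSeries.coeff m Q = ∑ k ∈ Finset.Icc 1 m, ((k ! : ℚ) / (m ! : ℚ) * (-1) ^ k) •
      MvPolynomial.aeval (fun i : Fin m => x (i + 1)) (bellPolynomial m k) := by
  set P : A⟦X⟧ := PowerSeries.mk fun i => (1 / (i ! : ℚ)) • x i with hP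
  set S : A⟦X⟧ := ∑ i : Fin m, PowerSeries.C ((1 / (((i : ℕ) + 1)! : ℚ)) • x (i + 1)) *
    PowerSeries.X ^ ((i : ℕ) + 1) with hS
  have hPS : (PowerSeries.X : A⟦X⟧) ^ (m + 1) ∣ P - (1 + S) := by
    rw [PowerSeries.X_pow_dvd_iff]
    intro n hn
    rw [hS, Fin.sum_univ_eq_sum_range (fun i => PowerSeries.C ((1 / ((i + 1)! : ℚ)) • x (i + 1)) *
      (PowerSeries.X : A⟦X⟧) ^ (i + 1)) m, map_sub, map_add, map_sum, hP, PowerSeries.coeff_mk]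
    simp only [PowerSeries.coeff_C_mul, PowerSeries.coeff_X_pow, mul_ite, mul_one, mul_zero]
    cases n with
    | zero => simp [hx]
    | succ n =>
      have hnm : n < m := by omega
      simp [PowerSeries.coeff_one, Finset.sum_ite_eq, hnm]
  have hXS : (PowerSeries.X : A⟦X⟧) ∣ -S :=
    (Finset.dvd_sum fun i _ => (dvd_pow_self _ (Nat.succ_ne_zero _)).mul_left _).neg_right
  have hgeom := mul_neg_geom_sum (-S) (m + 1)
  set G := ∑ k ∈ Finset.range (m + 1), (-S) ^ k with hG
  have hQG : (PowerSeries.X : A⟦X⟧) ^ (m + 1) ∣ Q - G := by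
    have h : Q - G = Q * ((-S) ^ (m + 1) - (P - (1 + S)) * G) := by
      linear_combination G * hQ - Q * hgeom
    rw [h]
    exact ((pow_dvd_pow_of_dvd hXS _).sub (hPS.mul_right _)).mul_left _
  have hcoeff := PowerSeries.X_pow_dvd_iff.1 hQG m (Nat.lt_succ_self m)
  rw [map_sub, sub_eq_zero] at hcoeff
  rw [hcoeff, hG, map_sum]
  have hsub : Finset.Icc 1 m ⊆ Finset.range (m + 1) := fun k hk => by
    rw [Finset.mem_Icc] at hk
    rw [Finset.mem_range]
    omega
  symm
  refine Finset.sum_subset_zero_on_sdiff hsub (fun k hk => ?_) (fun k _ => ?_)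
  · obtain rfl : k = 0 := by
      rw [Finset.mem_sdiff, Finset.mem_range, Finset.mem_Icc] at hk
      omega
    rw [pow_zero, PowerSeries.coeff_one, if_neg (by omega)]
  · have hneg : (-S) ^ k = PowerSeries.C (algebraMap ℚ A ((-1) ^ k)) * S ^ k := by
      rw [neg_pow, map_pow, map_pow, map_neg, map_neg, map_one, map_one]
    rw [hneg, PowerSeries.coeff_C_mul, ← Algebra.smul_def, hS,
      coeff_sum_pow_eq_aeval_bellPolynomial, smul_smul, mul_comm]

theorem mainTheorem2 :
    IsUnit (expHadamard expNegTSCD (liftT graphicSet)) ∧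
    graphicD = Ring.inverse (expHadamard expNegTSCD (liftT graphicSet)) ∧
    (∀ m : ℕ,
      graphicS m = coeffT m (Ring.inverse (expHadamard expNegTSCD (liftT graphicSet)))) ∧
    (∀ m : ℕ, 1 ≤ m →
      graphicS m =
        ∑ k ∈ Finset.Icc 1 m,
          ((k ! : ℚ) / (m ! : ℚ) * (-1) ^ (m + k)) •
            MvPolynomial.aeval
              (fun i : Fin m => expHadamard (SCD ^ ((i : ℕ) + 1)) graphicSet)
              (bellPolynomial m k)) := by
  have hmul := expHadamard_mul_graphicD
  have hunit : IsUnit (expHadamard expNegTSCD (liftT graphicSet)) := .of_mul_eq_one _ hmul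
  have hinv : graphicD = Ring.inverse (expHadamard expNegTSCD (liftT graphicSet)) := by
    rw [← mul_one (Ring.inverse _), ← hmul, Ring.inverse_mul_cancel_left _ _ hunit]
  refine ⟨hunit, hinv, fun m => hinv ▸ graphicS_eq_coeffT m, fun m hm => ?_⟩
  have hswap : swapVars (expHadamard expNegTSCD (liftT graphicSet)) * swapVars graphicD = 1 := by
    rw [← swapVars_mul, hmul, swapVars_one]
  have h0 : expHadamard (SCD ^ 0) graphicSet = 1 := by
    ext n
    rcases eq_or_ne n 0 with rfl | hn
    · simp [expHadamard, graphicSet, graphicGF]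
    · simp [expHadamard, PowerSeries.coeff_one, hn]
  have hP : swapVars (expHadamard expNegTSCD (liftT graphicSet)) = PowerSeries.mk fun i =>
      ((-1 : ℚ) ^ i / (i ! : ℚ)) • expHadamard (SCD ^ i) graphicSet := by
    ext i n
    have h := congrArg (PowerSeries.coeff n) (coeffT_expNegTSCD i)
    rw [coeffT, PowerSeries.coeff_mk, map_smul, smul_eq_mul] at h
    simp only [swapVars, PowerSeries.coeff_mk, coeffT, expHadamard, liftT, PowerSeries.coeff_map,
      map_smul, smul_eq_mul]
    rw [Polynomial.coeff_mul_C, ← map_natCast (Polynomial.C), Polynomial.coeff_C_mul, h]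
    ring
  -- the signs are removed by the substitution of `-t` for `t`
  have hresc : PowerSeries.rescale (-1) (swapVars (expHadamard expNegTSCD (liftT graphicSet))) =
      PowerSeries.mk fun i => (1 / (i ! : ℚ)) • expHadamard (SCD ^ i) graphicSet := by
    ext1 i
    have hsq : ((-1 : ℚ) ^ i * (-1) ^ i) = 1 := by rw [← mul_pow]; simp
    rw [hP, PowerSeries.coeff_rescale, PowerSeries.coeff_mk, PowerSeries.coeff_mk,
      show ((-1 : ℚ⟦X⟧) ^ i) = algebraMap ℚ ℚ⟦X⟧ ((-1) ^ i) by simp, ← Algebra.smul_def, smul_smul,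
      ← mul_div_assoc, hsq]
  have hone : (PowerSeries.mk fun i => (1 / (i ! : ℚ)) • expHadamard (SCD ^ i) graphicSet) *
      PowerSeries.rescale (-1) (swapVars graphicD) = 1 := by
    rw [← hresc, ← map_mul, hswap, map_one]
  have hm' := coeff_of_mk_mul_eq_one (x := fun i => expHadamard (SCD ^ i) graphicSet) h0 hone hm
  have hsq : ((-1 : ℚ⟦X⟧) ^ m * (-1) ^ m) = 1 := by rw [← mul_pow]; simp
  rw [PowerSeries.coeff_rescale, swapVars, PowerSeries.coeff_mk] at hm'
  rw [graphicS_eq_coeffT, ← one_mul (coeffT m graphicD), ← hsq, mul_assoc, hm', Finset.mul_sum]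
  refine Finset.sum_congr rfl fun k _ => ?_
  rw [show ((-1 : ℚ⟦X⟧) ^ m) = algebraMap ℚ ℚ⟦X⟧ ((-1) ^ m) by simp, ← Algebra.smul_def, smul_smul]
  congr 1
  ring
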